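/- Let $h:\{1,2,3,\dots\}\to(0,\infty)$ be a non-increasing function with $\sum_{k=1}^\infty \frac{h(k)}{k}<\infty$, and set $S_h(n):=\sum_{k=1}^n\frac{1}{k\,h(k)}$. For $n\ge 0$ let $V_n=\{0,\dots,n\}\times\{0,\dots,n\}$. A monotone path in $V_n$ is a sequence $(v_0,\dots,v_n)$ of vertices with $v_0=(0,0)$ and $v_i-v_{i-1}\in\{(1,0),(0,1)\}$ for $1\le i\le n$. Its monotone path function $P:V_n\to\mathbb{R}$ is given by $P(v)=-\|v\|_1$ if $v\in\{v_0,\dots,v_n\}$ and $P(v)=\|v\|_1$ otherwise; its unique minimum point is the endpoint $v_n$ of the path. Let $\mathrm{F}_n$ be the set of all monotone path functions on $V_n$. A deterministic algorithm $\mathcal{A}$ adaptively queries values of an unknown function $P:V_n\to\mathbb{R}$ at vertices, and finally stops and outputs a vertex. Let $\mathcal{G}(\mathcal{A},P)$ be the number of queries that it makes on $P$ if its output is a minimum point of $P$, and $\mathcal{G}(\mathcal{A},P)=\infty$ otherwise. A randomized algorithm is a random deterministic algorithm. Put $$\mathcal{G}_{\mathrm{rand}}(n):=\sup_{\mathcal{D}}\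 \inf_{\mathcal{A}\text{ deterministic}}\ \mathbb{E}_{P\sim\mathcal{D}}\left[\mathcal{G}(\mathcal{A},P)\right],$$ where $\mathcal{D}$ ranges over all probability distributions on $\mathrm{F}_n$. Theorem. $\displaystyle \mathcal{G}_{\mathrm{rand}}(n)=\Omega\left(\frac{n}{S_h(n)}\right)$, and likewise $\displaystyle \inf_{\mathcal{A}\text{ randomized}}\ \sup_{P\in\mathrm{F}_n}\ \mathbb{E}_{\mathcal{A}}\left[\mathcal{G}(\mathcal{A},P)\right]=\Omega\left(\frac{n}{S_h(n)}\right)$. That is, there are a constant $c>0$ and an integer $N$, depending only on $h$, such that both quantities are at least $c\,n/S_h(n)$ for all $n\ge N$. In particular, any randomized algorithm needs $\Omega(n/S_h(n))$ expected queries, in the worst case, to find the endpoint of a monotone path in the $(n+1)\times(n+1)$ grid. -/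

import Mathlib

open scoped ENNReal

namespace GridPath

/-- The vertex set `{0, …, n} × {0, …, n}` of the `(n+1) × (n+1)` grid. -/
abbrev Vertex (n : ℕ) : Type := Fin (n + 1) × Fin (n + 1)

/-- The `ℓ¹` norm `i + j` of the vertex `(i, j)`. -/
def l1norm {n : ℕ} (v : Vertex n) : ℕ := v.1.val + v.2.val

/-- A monotone path `(v₀, …, vₙ)`: it starts at the origin, and each step adds `(1, 0)` or `(0, 1)`. -/
structure MonotonePath (n : ℕ) where
  vertex : Fin (n + 1) → Vertex n
  start : vertex 0 = (0, 0)
  step : ∀ i : Fin n,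
    ((vertex i.succ).1.val = (vertex i.castSucc).1.val + 1 ∧
      (vertex i.succ).2.val = (vertex i.castSucc).2.val) ∨
    ((vertex i.succ).1.val = (vertex i.castSucc).1.val ∧
      (vertex i.succ).2.val = (vertex i.castSucc).2.val + 1)

open Classical in
/-- The function of a monotone path: `-‖v‖₁` at the vertices on the path, `‖v‖₁` at the others. -/
noncomputable def MonotonePath.toFun {n : ℕ} (p : MonotonePath n) (v : Vertex n) : ℝ :=
  if v ∈ Set.range p.vertex then -(l1norm v : ℝ) else (l1norm v : ℝ)

/-- The set of all monotone path functions on the grid. -/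
def pathFunctions (n : ℕ) : Set (Vertex n → ℝ) :=
  Set.range (MonotonePath.toFun (n := n))

/-- A deterministic adaptive query algorithm on the grid: it either stops and outputs a vertex, or
queries the value of the unknown function at a vertex and continues depending on the answer. -/
inductive QueryAlgorithm (n : ℕ) : Type
  | output (v : Vertex n) : QueryAlgorithm n
  | query (v : Vertex n) (next : ℝ → QueryAlgorithm n) : QueryAlgorithm n

namespace QueryAlgorithm

/-- The number of queries that the algorithm makes when run on `f`. -/
def numQueries {n : ℕ} : QueryAlgorithm n → (Vertex n → ℝ) → ℕ
  | output _, _ => 0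
  | query v next, f => numQueries (next (f v)) f + 1

/-- The vertex that the algorithm outputs when run on `f`. -/
def result {n : ℕ} : QueryAlgorithm n → (Vertex n → ℝ) → Vertex n
  | output v, _ => v
  | query v next, f => result (next (f v)) f

open Classical in
/-- The number of queries made by the algorithm in order to find a minimum point of `f`; it is
infinite if the output is not a minimum point. -/
noncomputable def cost {n : ℕ} (A : QueryAlgorithm n) (f : Vertex n → ℝ) : ℝ≥0∞ :=
  if ∀ u : Vertex n, f (A.result f) ≤ f u then (A.numQueries f : ℝ≥0∞) else ⊤

/-- The σ-algebra of events on deterministic algorithms: the smallest one for which, on every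
monotone path function, the number of queries and the output are measurable. -/
instance instMeasurableSpace (n : ℕ) : MeasurableSpace (QueryAlgorithm n) :=
  ⨆ P : pathFunctions n, MeasurableSpace.comap
    (fun A : QueryAlgorithm n => (A.numQueries P.1, A.result P.1)) ⊤

end QueryAlgorithm

/-- The distributional query complexity: the supremum, over all distributions on monotone path
functions, of the least expected number of queries of a deterministic algorithm. -/
noncomputable def distributionalComplexity (n : ℕ) : ℝ≥0∞ :=
  ⨆ D : PMF (pathFunctions n), ⨅ A : QueryAlgorithm n,
    ∑' P : pathFunctions n, D P * A.cost P.1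

/-- The randomized query complexity: the infimum, over all randomized algorithms (probability
measures on deterministic ones), of the worst-case expected number of queries. -/
noncomputable def randomizedComplexity (n : ℕ) : ℝ≥0∞ :=
  ⨅ μ : MeasureTheory.ProbabilityMeasure (QueryAlgorithm n), ⨆ P : pathFunctions n,
    ∫⁻ A : QueryAlgorithm n, A.cost P.1 ∂(μ : MeasureTheory.Measure (QueryAlgorithm n))

/-- `S_h(n) = ∑_{k=1}^n 1 / (k h(k))`. -/
noncomputable def partialSum (h : ℕ → ℝ) (n : ℕ) : ℝ :=
  ∑ k ∈ Finset.Icc 1 n, 1 / ((k : ℝ) * h k)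

end GridPath

open scoped MeasureTheory

namespace GridPath

/-! Choose the path at random so that its position k levels ahead is hard to predict: given a key
that fixes the path up to level i, each vertex at level i + k is hit with probability at most p k.
Fix i and charge p (ℓ - i) to a query at level ℓ > i, up to the first hit above level i. Until then
the answers reveal only the key and misses, and a query ends this phase with probability at most its
charge; so the expected charge for i is at least 1/2 (`card_sq_le_charge`). Over all i a single
query is charged at most ∑ p k, hence n / 2 ≤ (∑ p k) · E[queries + 1]
(`card_mul_le_sum_numQueries`).

To get p k of order 1 / (k h k), scale j receives its own residue class of times modulo 2 ^ d j, of
density comparable to h (2 ^ j). Summability of h k / k condenses to that of h (2 ^ j), so after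
scaling the classes can be made disjoint (`exists_disjoint_residues`). For d j ≤ j, a block of 2 ^ j
times contains r = 2 ^ (j - d j) times of the class, and an independent uniform variable in {0, …,
r} says how many of them are steps in the first direction. A window of length 2 ^ (j + 1) contains a
whole fresh block, and resampling it bounds each hit probability by 1 / (r + 1) (`card_hit_mul_le`).
Yao's principle transfers the bound to randomized algorithms. -/

/-! ### Values and minimum points of path functions -/

theorem MonotonePath.l1norm_vertex {n : ℕ} (p : MonotonePath n) (i : Fin (n + 1)) :
    l1norm (p.vertex i) = i.val := by
  induction i using Fin.induction with
  | zero => simp [p.start, l1norm]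
  | succ i ih =>
    have hs := p.step i
    simp only [l1norm, Fin.val_castSucc, Fin.val_succ] at *
    omega

theorem MonotonePath.mem_range_iff {n : ℕ} (p : MonotonePath n) (v : Vertex n) :
    v ∈ Set.range p.vertex ↔ ∃ i : Fin (n + 1), i.val = l1norm v ∧ p.vertex i = v := by
  constructor
  · rintro ⟨i, rfl⟩
    exact ⟨i, (p.l1norm_vertex i).symm, rfl⟩
  · rintro ⟨i, -, h⟩
    exact ⟨i, h⟩

/-- At the origin both cases of the definition give 0. So an answer is either negative, a genuine
hit, or a value known in advance. -/
theorem MonotonePath.toFun_eq_or {n : ℕ} (p : MonotonePath n) (v : Vertex n) :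
    p.toFun v = l1norm v ∨ p.toFun v < 0 := by
  unfold MonotonePath.toFun
  split_ifs with h
  · rcases Nat.eq_zero_or_pos (l1norm v) with h0 | h0
    · left; simp [h0]
    · right
      have : (0 : ℝ) < l1norm v := by exact_mod_cast h0
      linarith
  · exact Or.inl rfl

theorem MonotonePath.mem_range_of_toFun_neg {n : ℕ} (p : MonotonePath n) {v : Vertex n}
    (h : p.toFun v < 0) : v ∈ Set.range p.vertex := by
  by_contra hv
  rw [MonotonePath.toFun, if_neg hv] at h
  exact absurd h (not_lt.2 (Nat.cast_nonneg _))

/-- The minimum point of a monotone path function is the endpoint of the path. -/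
theorem MonotonePath.eq_last_of_isMin {n : ℕ} (p : MonotonePath n) (hn : 0 < n) {v : Vertex n}
    (h : ∀ u, p.toFun v ≤ p.toFun u) : v = p.vertex (Fin.last n) := by
  have hlast : p.toFun (p.vertex (Fin.last n)) = -(n : ℝ) := by
    rw [MonotonePath.toFun, if_pos ⟨_, rfl⟩, p.l1norm_vertex, Fin.val_last]
  have h1 := h (p.vertex (Fin.last n))
  rw [hlast] at h1
  have hn' : (0 : ℝ) < n := by exact_mod_cast hn
  obtain ⟨i, rfl⟩ := p.mem_range_of_toFun_neg (show p.toFun v < 0 by linarith)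
  rw [MonotonePath.toFun, if_pos ⟨_, rfl⟩, p.l1norm_vertex, neg_le_neg_iff] at h1
  have h2 : n ≤ i.val := by exact_mod_cast h1
  congr 1
  exact Fin.ext (by simp; omega)

/-! ### The charging argument -/

/-- The value charged, at level `i`, to a query at `v`. -/
noncomputable def levelWeight {n : ℕ} (p : ℕ → ℝ) (i : ℕ) (v : Vertex n) : ℝ :=
  if i < l1norm v ∧ l1norm v ≤ n then p (l1norm v - i) else 0

namespace QueryAlgorithm

open Classical in
/-- The total charge, at level `i`, of the queries up to the first one that finds a vertex above
level `i`; the output is charged like a query. -/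
noncomputable def charge {n : ℕ} (p : ℕ → ℝ) (i : ℕ) :
    QueryAlgorithm n → (Vertex n → ℝ) → ℝ
  | output v, _ => levelWeight p i v
  | query v next, f =>
    levelWeight p i v + if i < l1norm v ∧ f v < 0 then 0 else charge p i (next (f v)) f

end QueryAlgorithm

theorem levelWeight_nonneg {n : ℕ} {p : ℕ → ℝ} (hp : ∀ k, 0 ≤ p k) (i : ℕ) (v : Vertex n) :
    0 ≤ levelWeight p i v := by
  unfold levelWeight
  split_ifs
  exacts [hp _, le_rfl]

theorem QueryAlgorithm.charge_nonneg {n : ℕ} {p : ℕ → ℝ} (hp : ∀ k, 0 ≤ p k) (i : ℕ)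
    (A : QueryAlgorithm n) (f : Vertex n → ℝ) : 0 ≤ A.charge p i f := by
  induction A with
  | output v => exact levelWeight_nonneg hp i v
  | query v next ih =>
    rw [QueryAlgorithm.charge]
    have := levelWeight_nonneg hp i v
    split_ifs
    · linarith
    · linarith [ih (f v)]

/-- Distinct levels i below v lie at distinct distances from it, so each p k is used at most once.
-/
theorem sum_levelWeight_le {n : ℕ} {p : ℕ → ℝ} (hp : ∀ k, 0 ≤ p k) (v : Vertex n) :
    ∑ i ∈ Finset.range n, levelWeight p i v ≤ ∑ k ∈ Finset.Icc 1 n, p k := by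
  unfold levelWeight
  rw [← Finset.sum_filter]
  have hinj : Set.InjOn (fun i => l1norm v - i)
      ((Finset.range n).filter fun i => i < l1norm v ∧ l1norm v ≤ n : Finset ℕ) := by
    intro a ha b hb hab
    simp only [Finset.coe_filter, Set.mem_ofPred_eq] at ha hb hab
    omega
  rw [← Finset.sum_image (f := p) hinj]
  refine Finset.sum_le_sum_of_subset_of_nonneg ?_ fun k _ _ => hp k
  intro k hk
  obtain ⟨a, ha, rfl⟩ := Finset.mem_image.1 hk
  simp only [Finset.mem_filter, Finset.mem_range, Finset.mem_Icc] at ha ⊢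
  omega

theorem QueryAlgorithm.sum_charge_le {n : ℕ} {p : ℕ → ℝ} (hp : ∀ k, 0 ≤ p k)
    (A : QueryAlgorithm n) (f : Vertex n → ℝ) :
    ∑ i ∈ Finset.range n, A.charge p i f ≤
      (∑ k ∈ Finset.Icc 1 n, p k) * (A.numQueries f + 1) := by
  induction A with
  | output v =>
    simpa [QueryAlgorithm.charge, QueryAlgorithm.numQueries] using sum_levelWeight_le hp v
  | query v next ih =>
    have h1 : ∑ i ∈ Finset.range n, (query v next).charge p i f ≤
        ∑ i ∈ Finset.range n, (levelWeight p i v + (next (f v)).charge p i f) := by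
      refine Finset.sum_le_sum fun i _ => ?_
      rw [QueryAlgorithm.charge]
      have := (next (f v)).charge_nonneg hp i f
      split_ifs <;> linarith
    rw [Finset.sum_add_distrib] at h1
    have h2 := sum_levelWeight_le hp v
    have h3 := ih (f v)
    simp only [QueryAlgorithm.numQueries]
    push_cast
    linarith

-- N is the part of the cell c still consistent with a run of misses. The quadratic form makes the
-- induction close: losing w · |c| elements of N lowers |N|² by at most 2 |c| · w |N|, and w |N| is
-- what N is charged for that query.
open Classical in
theorem card_sq_le_charge {n : ℕ} {Ω : Type*} (path : Ω → MonotonePath n) (c : Finset Ω) {i : ℕ}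
    (hi : i < n) {p : ℕ → ℝ} (hp : ∀ k, 0 ≤ p k)
    (hagree : ∀ ω ∈ c, ∀ ω' ∈ c, ∀ v, l1norm v ≤ i → (path ω).toFun v = (path ω').toFun v)
    (hhit : ∀ v : Vertex n, i < l1norm v → l1norm v ≤ n →
      ((c.filter fun ω => v ∈ Set.range (path ω).vertex).card : ℝ) ≤ p (l1norm v - i) * c.card)
    (A : QueryAlgorithm n) (N : Finset Ω) (hN : N ⊆ c)
    (hA : ∀ ω ∈ N, A.result (path ω).toFun = (path ω).vertex (Fin.last n)) :
    (N.card : ℝ) ^ 2 ≤ 2 * c.card * ∑ ω ∈ N, A.charge p i (path ω).toFun := by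
  induction A generalizing N with
  | output v =>
    rcases N.eq_empty_or_nonempty with rfl | ⟨ω₀, hω₀⟩
    · simp
    have hv : l1norm v = n := by
      have := hA ω₀ hω₀
      simp only [QueryAlgorithm.result] at this
      rw [this, MonotonePath.l1norm_vertex, Fin.val_last]
    -- One output is correct for all of N, so all these paths hit the same vertex of level n.
    have h1 : (N.card : ℝ) ≤ p (l1norm v - i) * c.card := by
      refine le_trans ?_ (hhit v (by omega) hv.le)
      gcongr
      intro ω hω
      exact Finset.mem_filter.2 ⟨hN hω, ⟨_, (hA ω hω).symm⟩⟩
    have h2 : ∑ ω ∈ N, (QueryAlgorithm.output v).charge p i (path ω).toFun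
        = N.card * p (l1norm v - i) := by
      simp [QueryAlgorithm.charge, levelWeight, hv, hi]
    rw [h2]
    have := mul_le_mul_of_nonneg_left h1 (Nat.cast_nonneg (α := ℝ) N.card)
    have : 0 ≤ (N.card : ℝ) * (p (l1norm v - i) * c.card) :=
      mul_nonneg (Nat.cast_nonneg _) (mul_nonneg (hp _) (Nat.cast_nonneg _))
    nlinarith
  | query v next ih =>
    rcases N.eq_empty_or_nonempty with rfl | ⟨ω₀, hω₀⟩
    · simp
    by_cases hvi : i < l1norm v
    -- All paths that miss v give the same answer, so the run on N' continues in a single branch.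
    · set N' := N.filter fun ω => ¬ (path ω).toFun v < 0 with hN'
      have hval : ∀ ω ∈ N', (path ω).toFun v = l1norm v := fun ω hω =>
        ((path ω).toFun_eq_or v).resolve_right (Finset.mem_filter.1 hω).2
      have hle := ih (l1norm v) N' ((Finset.filter_subset _ _).trans hN) (fun ω hω => by
        have := hA ω (Finset.mem_filter.1 hω).1
        rwa [QueryAlgorithm.result, hval ω hω] at this)
      have hsum : ∑ ω ∈ N, (QueryAlgorithm.query v next).charge p i (path ω).toFun =
          N.card * levelWeight p i v +
            ∑ ω ∈ N', (next (l1norm v)).charge p i (path ω).toFun := by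
        simp only [QueryAlgorithm.charge, Finset.sum_add_distrib, Finset.sum_const, nsmul_eq_mul]
        congr 1
        rw [hN', Finset.sum_filter]
        refine Finset.sum_congr rfl fun ω hω => ?_
        by_cases hneg : (path ω).toFun v < 0
        · simp [hvi, hneg]
        · rw [if_neg (by tauto), if_pos hneg,
            ((path ω).toFun_eq_or v).resolve_right hneg]
      have hdiff : (N.card : ℝ) ≤ N'.card + levelWeight p i v * c.card := by
        have hsplit := Finset.card_filter_add_card_filter_not (s := N)
          (fun ω => (path ω).toFun v < 0)
        rw [← hN'] at hsplit
        have hb : ((N.filter fun ω => (path ω).toFun v < 0).card : ℝ) ≤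
            levelWeight p i v * c.card := by
          by_cases hvn : l1norm v ≤ n
          · rw [levelWeight, if_pos ⟨hvi, hvn⟩]
            refine le_trans ?_ (hhit v hvi hvn)
            gcongr
            intro ω hω
            obtain ⟨hω, hneg⟩ := Finset.mem_filter.1 hω
            exact Finset.mem_filter.2 ⟨hN hω, (path ω).mem_range_of_toFun_neg hneg⟩
          · have : (N.filter fun ω => (path ω).toFun v < 0) = ∅ := by
              refine Finset.filter_eq_empty_iff.2 fun ω _ hneg => hvn ?_
              obtain ⟨t, ht, -⟩ := ((path ω).mem_range_iff v).1
                ((path ω).mem_range_of_toFun_neg hneg)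
              omega
            rw [this]
            simpa using mul_nonneg (levelWeight_nonneg hp i v) (Nat.cast_nonneg _)
        have : (N.card : ℝ) = (N.filter fun ω => (path ω).toFun v < 0).card + N'.card := by
          exact_mod_cast hsplit.symm
        linarith
      have hsub : (N'.card : ℝ) ≤ N.card := by
        exact_mod_cast Finset.card_le_card (Finset.filter_subset _ _)
      rw [hsum]
      have h0 : (0 : ℝ) ≤ N'.card := Nat.cast_nonneg _
      have hw := mul_nonneg (levelWeight_nonneg hp i v) (Nat.cast_nonneg (α := ℝ) c.card)
      -- Uses |N|² - |N'|² = (|N| - |N'|)(|N| + |N'|) together with |N'| ≤ |N|.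
      nlinarith [mul_le_mul_of_nonneg_right (sub_le_iff_le_add'.2 hdiff)
        (add_nonneg (Nat.cast_nonneg (α := ℝ) N.card) h0),
        mul_le_mul_of_nonneg_left hsub hw]
    -- A query at level at most i is free and does not split the cell.
    · have hval : ∀ ω ∈ N, (path ω).toFun v = (path ω₀).toFun v := fun ω hω =>
        hagree ω (hN hω) ω₀ (hN hω₀) v (by omega)
      have hle := ih ((path ω₀).toFun v) N hN (fun ω hω => by
        have := hA ω hω
        rwa [QueryAlgorithm.result, hval ω hω] at this)
      refine hle.trans_eq ?_
      congr 1
      refine Finset.sum_congr rfl fun ω hω => ?_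
      rw [QueryAlgorithm.charge, if_neg (by tauto), levelWeight, if_neg (by tauto), zero_add,
        hval ω hω]

open Classical in
/-- If the level-`(i + k)` vertex of a random path has conditional probability at most `p k` given
the information `key i`, which determines the path up to level `i`, then finding the endpoint is
expensive on average. -/
theorem card_mul_le_sum_numQueries {n : ℕ} {Ω κ : Type*} [Fintype Ω]
    (path : Ω → MonotonePath n) (key : ℕ → Ω → κ) {p : ℕ → ℝ} (hp : ∀ k, 0 ≤ p k)
    (hagree : ∀ i ω ω', key i ω = key i ω' → ∀ v, l1norm v ≤ i →
      (path ω).toFun v = (path ω').toFun v)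
    (hhit : ∀ i ω₀ (v : Vertex n), i < l1norm v → l1norm v ≤ n →
      ((Finset.univ.filter fun ω => key i ω = key i ω₀ ∧ v ∈ Set.range (path ω).vertex).card : ℝ) ≤
        p (l1norm v - i) * (Finset.univ.filter fun ω => key i ω = key i ω₀).card)
    (A : QueryAlgorithm n)
    (hA : ∀ ω, A.result (path ω).toFun = (path ω).vertex (Fin.last n)) :
    (n : ℝ) * Fintype.card Ω ≤
      2 * (∑ k ∈ Finset.Icc 1 n, p k) * ∑ ω, ((A.numQueries (path ω).toFun : ℝ) + 1) := by
  have hlevel : ∀ i ∈ Finset.range n,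
      (Fintype.card Ω : ℝ) ≤ 2 * ∑ ω, A.charge p i (path ω).toFun := by
    intro i hi
    rw [Finset.mem_range] at hi
    have hmaps : ∀ ω ∈ (Finset.univ : Finset Ω), key i ω ∈ Finset.univ.image (key i) :=
      fun ω hω => Finset.mem_image_of_mem _ hω
    rw [← Finset.card_univ, Finset.card_eq_sum_card_fiberwise hmaps,
      ← Finset.sum_fiberwise_of_maps_to hmaps, Finset.mul_sum]
    push_cast
    refine Finset.sum_le_sum fun b hb => ?_
    obtain ⟨ω₀, -, rfl⟩ := Finset.mem_image.1 hb
    set c := Finset.univ.filter fun ω => key i ω = key i ω₀ with hc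
    have hcpos : (0 : ℝ) < c.card := by
      exact_mod_cast Finset.card_pos.2 ⟨ω₀, by simp [hc]⟩
    have := card_sq_le_charge path c hi hp
      (fun ω hω ω' hω' v hv => hagree i ω ω'
        ((Finset.mem_filter.1 hω).2.trans (Finset.mem_filter.1 hω').2.symm) v hv)
      (fun v h1 h2 => by
        have := hhit i ω₀ v h1 h2
        rwa [hc, Finset.filter_filter]) A c subset_rfl (fun ω _ => hA ω)
    -- For N = c, one factor |c| cancels.
    nlinarith
  have hsum := Finset.sum_le_sum hlevel
  rw [Finset.sum_const, Finset.card_range, nsmul_eq_mul, ← Finset.mul_sum, Finset.sum_comm] at hsum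
  refine hsum.trans ?_
  rw [mul_assoc, Finset.mul_sum _ _ (∑ k ∈ Finset.Icc 1 n, p k)]
  gcongr with ω
  exact A.sum_charge_le hp _

/-! ### Paths given by step sequences -/

/-- The monotone path whose `t`-th step goes in the first direction exactly when `s t` holds. -/
def MonotonePath.ofSteps (n : ℕ) (s : ℕ → Prop) [DecidablePred s] : MonotonePath n where
  vertex i := (⟨Nat.count s i, by have := Nat.count_le (p := s) (n := i.val); omega⟩,
    ⟨i - Nat.count s i, by omega⟩)
  start := by simp
  step i := by
    have := Nat.count_le (p := s) (n := i.val)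
    by_cases h : s i <;> grind

theorem MonotonePath.ofSteps_vertex_fst (n : ℕ) (s : ℕ → Prop) [DecidablePred s]
    (i : Fin (n + 1)) : ((MonotonePath.ofSteps n s).vertex i).1.val = Nat.count s i := rfl

theorem MonotonePath.ofSteps_vertex_snd (n : ℕ) (s : ℕ → Prop) [DecidablePred s]
    (i : Fin (n + 1)) : ((MonotonePath.ofSteps n s).vertex i).2.val = i - Nat.count s i := rfl

instance MonotonePath.finite (n : ℕ) : Finite (MonotonePath n) := by
  refine Finite.of_injective MonotonePath.vertex fun p q h => ?_
  cases p; cases q; cases h; rfl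

instance finite_pathFunctions (n : ℕ) : Finite (pathFunctions n) :=
  Set.finite_range _

/-! ### Yao's principle and uniformly random paths -/

theorem QueryAlgorithm.measurable_cost {n : ℕ} (P : pathFunctions n) :
    Measurable fun A : QueryAlgorithm n => A.cost P.1 := by
  classical
  have h : Measurable[MeasurableSpace.comap
      (fun A : QueryAlgorithm n => (A.numQueries P.1, A.result P.1)) ⊤]
      fun A : QueryAlgorithm n => A.cost P.1 := by
    have : (fun A : QueryAlgorithm n => A.cost P.1) =
        (fun x : ℕ × Vertex n => if ∀ u, P.1 x.2 ≤ P.1 u then (x.1 : ℝ≥0∞) else ⊤) ∘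
          fun A : QueryAlgorithm n => (A.numQueries P.1, A.result P.1) := rfl
    rw [this]
    exact (@measurable_from_top _ _ _ _).comp (comap_measurable _)
  exact h.mono (le_iSup (fun P : pathFunctions n => MeasurableSpace.comap
    (fun A : QueryAlgorithm n => (A.numQueries P.1, A.result P.1)) ⊤) P) le_rfl

/-- The easy direction of Yao's principle. -/
theorem distributionalComplexity_le_randomizedComplexity (n : ℕ) :
    distributionalComplexity n ≤ randomizedComplexity n := by
  refine iSup_le fun D => le_iInf fun μ => ?_
  calc ⨅ A : QueryAlgorithm n, ∑' P : pathFunctions n, D P * A.cost P.1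
      = ∫⁻ _ : QueryAlgorithm n, (⨅ A : QueryAlgorithm n,
          ∑' P : pathFunctions n, D P * A.cost P.1) ∂(μ : MeasureTheory.Measure _) := by simp
    _ ≤ ∫⁻ A : QueryAlgorithm n, ∑' P : pathFunctions n, D P * A.cost P.1
          ∂(μ : MeasureTheory.Measure _) :=
        MeasureTheory.lintegral_mono fun A => iInf_le _ A
    _ = ∑' P : pathFunctions n, D P * ∫⁻ A : QueryAlgorithm n, A.cost P.1
          ∂(μ : MeasureTheory.Measure _) := by
        rw [MeasureTheory.lintegral_tsum fun P =>
          ((QueryAlgorithm.measurable_cost P).const_mul _).aemeasurable]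
        exact tsum_congr fun P =>
          MeasureTheory.lintegral_const_mul _ (QueryAlgorithm.measurable_cost P)
    _ ≤ ∑' P : pathFunctions n, D P * ⨆ P : pathFunctions n, ∫⁻ A : QueryAlgorithm n, A.cost P.1
          ∂(μ : MeasureTheory.Measure _) := by
        refine ENNReal.tsum_le_tsum fun P => ?_
        gcongr
        exact le_iSup (fun P : pathFunctions n => ∫⁻ A : QueryAlgorithm n, A.cost P.1
          ∂(μ : MeasureTheory.Measure _)) P
    _ = _ := by rw [ENNReal.tsum_mul_right, D.tsum_coe, one_mul]

theorem tsum_map_mul {α β : Type*} (q : PMF α) (g : α → β) (F : β → ℝ≥0∞) :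
    ∑' b, q.map g b * F b = ∑' a, q a * F (g a) := by
  classical
  simp only [PMF.map_apply, ← ENNReal.tsum_mul_right]
  rw [ENNReal.tsum_comm]
  refine tsum_congr fun a => ?_
  rw [tsum_eq_single (g a) fun b hb => by simp [hb]]
  simp

/-- A lower bound on the average cost over a uniformly random path bounds the distributional
complexity. -/
theorem le_distributionalComplexity {n : ℕ} (hn : 0 < n) {Ω : Type*} [Fintype Ω] [Nonempty Ω]
    (path : Ω → MonotonePath n) (x : ℝ≥0∞)
    (h : ∀ A : QueryAlgorithm n,
      (∀ ω, A.result (path ω).toFun = (path ω).vertex (Fin.last n)) →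
      x * Fintype.card Ω ≤ ∑ ω, (A.numQueries (path ω).toFun : ℝ≥0∞)) :
    x ≤ distributionalComplexity n := by
  classical
  refine le_iSup_of_le ((PMF.uniformOfFintype Ω).map
    fun ω => (⟨(path ω).toFun, path ω, rfl⟩ : pathFunctions n)) (le_iInf fun A => ?_)
  rw [tsum_map_mul _ _ fun P : pathFunctions n => A.cost P.1, tsum_fintype]
  simp only [PMF.uniformOfFintype_apply]
  rw [← Finset.mul_sum, mul_comm, ← div_eq_mul_inv, ENNReal.le_div_iff_mul_le
    (Or.inl (by simp)) (Or.inl (by simp))]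
  by_cases hA : ∀ ω, ∀ u, (path ω).toFun (A.result (path ω).toFun) ≤ (path ω).toFun u
  · refine (h A fun ω => (path ω).eq_last_of_isMin hn (hA ω)).trans ?_
    refine Finset.sum_le_sum fun ω _ => ?_
    rw [QueryAlgorithm.cost, if_pos (hA ω)]
  · obtain ⟨ω, hω⟩ := not_forall.1 hA
    have : ∑ ω, A.cost (path ω).toFun = ⊤ :=
      ENNReal.sum_eq_top.2 ⟨ω, Finset.mem_univ _, by rw [QueryAlgorithm.cost, if_neg hω]⟩
    rw [this]
    exact le_top

/-- Two paths with different endpoints defeat any algorithm that makes no query. This covers the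
range where the additive 1 in the charging bound is not negligible. -/
theorem one_le_distributionalComplexity {n : ℕ} (hn : 0 < n) :
    1 ≤ distributionalComplexity n := by
  refine le_distributionalComplexity hn
    (fun b : Bool => MonotonePath.ofSteps n fun _ => b = true) 1 fun A hA => ?_
  cases A with
  | output v =>
    exfalso
    have h := (hA true).symm.trans (hA false)
    have h' := congrArg (fun v : Vertex n => v.1.val) h
    simp [MonotonePath.ofSteps_vertex_fst, Nat.count_true, Nat.count_false] at h'
    omega
  | query v next =>
    simp only [QueryAlgorithm.numQueries]
    push_cast
    rw [one_mul, ← Finset.card_univ, Finset.card_eq_sum_ones]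
    push_cast
    exact Finset.sum_le_sum fun ω _ => le_add_self

/-- The distributional complexity is bounded below in terms of the predictability of a random
path. -/
theorem ofReal_le_distributionalComplexity {n : ℕ} (hn : 0 < n) {Ω : Type*} [Fintype Ω]
    [Nonempty Ω] (path : Ω → MonotonePath n) {S : ℝ} (hS : 0 < S)
    (h : ∀ A : QueryAlgorithm n,
      (∀ ω, A.result (path ω).toFun = (path ω).vertex (Fin.last n)) →
      (n : ℝ) * Fintype.card Ω ≤ 2 * S * ∑ ω, ((A.numQueries (path ω).toFun : ℝ) + 1)) :
    ENNReal.ofReal (n / (4 * S)) ≤ distributionalComplexity n := by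
  by_cases hlarge : (n : ℝ) / (4 * S) ≤ 1
  · refine le_trans ?_ (one_le_distributionalComplexity hn)
    rw [← ENNReal.ofReal_one]
    exact ENNReal.ofReal_le_ofReal hlarge
  -- Here n / (4S) > 1, so n / (2S) - 1 ≥ n / (4S).
  · push Not at hlarge
    refine le_distributionalComplexity hn path _ fun A hA => ?_
    have h1 := h A hA
    have hcard : (0 : ℝ) < Fintype.card Ω := by exact_mod_cast Fintype.card_pos
    rw [Finset.sum_add_distrib] at h1
    simp only [Finset.sum_const, Finset.card_univ, nsmul_eq_mul, mul_one] at h1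
    rw [lt_div_iff₀ (by positivity), one_mul] at hlarge
    have h2 : (n : ℝ) / (4 * S) * Fintype.card Ω ≤ ∑ ω, (A.numQueries (path ω).toFun : ℝ) := by
      rw [div_mul_eq_mul_div, div_le_iff₀ (by positivity)]
      nlinarith [mul_lt_mul_of_pos_right hlarge hcard]
    calc ENNReal.ofReal (n / (4 * S)) * Fintype.card Ω
        = ENNReal.ofReal (n / (4 * S) * Fintype.card Ω) := by
          rw [ENNReal.ofReal_mul (by positivity), ENNReal.ofReal_natCast]
      _ ≤ ENNReal.ofReal (∑ ω, (A.numQueries (path ω).toFun : ℝ)) :=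
          ENNReal.ofReal_le_ofReal h2
      _ = _ := by
          rw [ENNReal.ofReal_sum_of_nonneg fun _ _ => Nat.cast_nonneg _]
          simp

/-! ### Paths driven by independent blocks -/

theorem MonotonePath.mem_range_ofSteps_iff {n : ℕ} (s : ℕ → Prop) [DecidablePred s]
    (v : Vertex n) : v ∈ Set.range (MonotonePath.ofSteps n s).vertex ↔
      l1norm v ≤ n ∧ Nat.count s (l1norm v) = v.1.val := by
  constructor
  · rintro ⟨i, rfl⟩
    rw [MonotonePath.l1norm_vertex, MonotonePath.ofSteps_vertex_fst]
    exact ⟨by omega, rfl⟩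
  · rintro ⟨h1, h2⟩
    refine ⟨⟨l1norm v, by omega⟩, Prod.ext (Fin.ext h2) (Fin.ext ?_)⟩
    rw [MonotonePath.ofSteps_vertex_snd]
    simp only [h2]
    simp [l1norm]

section Blocks

variable {κ : Type*} {r : κ → ℕ}

/-- The step process driven by independent variables `ω x`: time `t` belongs to the block `x` when
`T x t` holds, its rank in the block is `ρ x t`, and the first `ω x` times of the block are steps in
the first direction. -/
def blockStep (T : κ → ℕ → Prop) (ρ : κ → ℕ → ℕ) (ω : ∀ x, Fin (r x + 1)) (t : ℕ) : Prop :=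
  ∃ x, T x t ∧ ρ x t < (ω x).val

/-- The variables of the blocks that start before time `i`. -/
def blockKey (start : κ → ℕ) (i : ℕ) (ω : ∀ x, Fin (r x + 1)) (x : κ) : Option (Fin (r x + 1)) :=
  if start x < i then some (ω x) else none

variable {T : κ → ℕ → Prop} {ρ : κ → ℕ → ℕ} {start finish : κ → ℕ}

theorem blockKey_eq_iff {i : ℕ} {ω ω' : ∀ x, Fin (r x + 1)} :
    blockKey start i ω = blockKey start i ω' ↔ ∀ x, start x < i → ω x = ω' x := by
  rw [funext_iff]
  refine forall_congr' fun x => ?_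
  unfold blockKey
  split_ifs with h <;> simp [h]

open Classical in
theorem count_blockStep_congr (hstart : ∀ x t, T x t → start x ≤ t) {i ℓ : ℕ} (hℓ : ℓ ≤ i)
    {ω ω' : ∀ x, Fin (r x + 1)} (h : blockKey start i ω = blockKey start i ω') :
    Nat.count (blockStep T ρ ω) ℓ = Nat.count (blockStep T ρ ω') ℓ := by
  rw [blockKey_eq_iff] at h
  rw [Nat.count_eq_card_filter_range, Nat.count_eq_card_filter_range]
  congr 1
  refine Finset.filter_congr fun t ht => ?_
  rw [Finset.mem_range] at ht
  unfold blockStep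
  refine exists_congr fun x => and_congr_right fun hx => ?_
  rw [h x (by have := hstart x t hx; omega)]

-- Raising the variable of y from u to u' adds the time of rank u as a new step; no other block
-- contains that time, and it precedes ℓ.
open Classical in
theorem count_blockStep_update_lt (hfinish : ∀ x t, T x t → t < finish x)
    (hunique : ∀ x y t, T x t → T y t → x = y) {y : κ}
    (hsurj : ∀ u < r y, ∃ t, T y t ∧ ρ y t = u) {ℓ : ℕ} (hℓ : finish y ≤ ℓ)
    (ω : ∀ x, Fin (r x + 1)) {u u' : Fin (r y + 1)} (huu : u < u') :
    Nat.count (blockStep T ρ (Function.update ω y u)) ℓ <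
      Nat.count (blockStep T ρ (Function.update ω y u')) ℓ := by
  rw [Nat.count_eq_card_filter_range, Nat.count_eq_card_filter_range]
  have huu' : u.val < u'.val := huu
  obtain ⟨t, ht, hρ⟩ := hsurj u.val (by omega)
  refine Finset.card_lt_card ((Finset.ssubset_iff_of_subset ?_).2 ⟨t, ?_, ?_⟩)
  · intro s hs
    simp only [Finset.mem_filter] at hs ⊢
    refine ⟨hs.1, ?_⟩
    obtain ⟨x, hx, hlt⟩ := hs.2
    refine ⟨x, hx, ?_⟩
    by_cases hxy : x = y
    · subst hxy
      rw [Function.update_self] at hlt ⊢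
      omega
    · rwa [Function.update_of_ne hxy] at hlt ⊢
  · have := hfinish y t ht
    refine Finset.mem_filter.2 ⟨Finset.mem_range.2 (by omega), y, ht, ?_⟩
    rw [Function.update_self]
    omega
  · intro hmem
    obtain ⟨x, hx, hlt⟩ := (Finset.mem_filter.1 hmem).2
    obtain rfl := hunique x y t hx ht
    rw [Function.update_self] at hlt
    omega

-- Resampling the variable of y stays in the cell, since the key does not see y. It is injective on
-- hits: by strict monotonicity, the other variables and the count a determine the original value at
-- y.
open Classical in
theorem card_hit_mul_le [Fintype κ] (hfinish : ∀ x t, T x t → t < finish x)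
    (hunique : ∀ x y t, T x t → T y t → x = y) {y : κ}
    (hsurj : ∀ u < r y, ∃ t, T y t ∧ ρ y t = u) {i ℓ : ℕ} (hi : i ≤ start y) (hℓ : finish y ≤ ℓ)
    (ω₀ : ∀ x, Fin (r x + 1)) (a : ℕ) :
    (Finset.univ.filter fun ω : ∀ x, Fin (r x + 1) => blockKey start i ω = blockKey start i ω₀ ∧
        Nat.count (blockStep T ρ ω) ℓ = a).card * (r y + 1) ≤
      (Finset.univ.filter fun ω : ∀ x, Fin (r x + 1) =>
        blockKey start i ω = blockKey start i ω₀).card := by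
  have hfin : (Finset.univ : Finset (Fin (r y + 1))).card = r y + 1 := by simp
  conv_lhs => rw [← hfin, ← Finset.card_product]
  refine Finset.card_le_card_of_injOn (fun z => Function.update z.1 y z.2) ?_ ?_
  · rintro ⟨ω, u⟩ h
    simp only [Finset.coe_product, Set.mem_prod, Finset.mem_coe, Finset.mem_filter,
      Finset.mem_univ, true_and, and_true, blockKey_eq_iff] at h ⊢
    intro x hx
    rw [Function.update_of_ne (by rintro rfl; omega)]
    exact h.1 x hx
  · rintro ⟨ω, u⟩ h ⟨ω', u'⟩ h' heq
    simp only [Finset.coe_product, Set.mem_prod, Finset.mem_coe, Finset.mem_filter,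
      Finset.mem_univ, true_and, and_true] at h h' heq
    have hu : u = u' := by simpa using congrFun heq y
    subst hu
    have hω : Function.update ω y (ω' y) = ω' := by
      have := congrArg (fun η => Function.update η y (ω' y)) heq
      simpa using this
    have hy : ω y = ω' y := by
      by_contra hne
      rcases lt_or_gt_of_ne hne with hlt | hlt
      all_goals
        have := count_blockStep_update_lt hfinish hunique hsurj hℓ ω hlt
        rw [hω, Function.update_eq_self, h.2, h'.2] at this
        exact lt_irrefl _ this
    rw [← hy, Function.update_eq_self] at hω
    rw [hω]

open Classical in
theorem ofReal_le_distributionalComplexity_of_blocks [Fintype κ] {n : ℕ} (hn : 0 < n)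
    (hstart : ∀ x t, T x t → start x ≤ t) (hfinish : ∀ x t, T x t → t < finish x)
    (hunique : ∀ x y t, T x t → T y t → x = y)
    (hsurj : ∀ y, ∀ u < r y, ∃ t, T y t ∧ ρ y t = u) {p : ℕ → ℝ} (hp : ∀ k, 0 ≤ p k)
    (hS : 0 < ∑ k ∈ Finset.Icc 1 n, p k)
    (hblock : ∀ i ℓ, i < ℓ → ℓ ≤ n → 1 ≤ p (ℓ - i) ∨
      ∃ y, i ≤ start y ∧ finish y ≤ ℓ ∧ 1 ≤ p (ℓ - i) * (r y + 1)) :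
    ENNReal.ofReal (n / (4 * ∑ k ∈ Finset.Icc 1 n, p k)) ≤ distributionalComplexity n := by
  refine ofReal_le_distributionalComplexity hn
    (fun ω : ∀ x, Fin (r x + 1) => MonotonePath.ofSteps n (blockStep T ρ ω)) hS
    (card_mul_le_sum_numQueries _ (blockKey start) hp ?_ ?_)
  · intro i ω ω' h v hv
    simp only [MonotonePath.toFun, MonotonePath.mem_range_ofSteps_iff,
      count_blockStep_congr hstart hv h]
  · intro i ω₀ v hi hv
    simp only [MonotonePath.mem_range_ofSteps_iff, hv, true_and]
    rcases hblock i _ hi hv with h | ⟨y, h1, h2, h3⟩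
    · refine le_trans ?_ (le_mul_of_one_le_left (Nat.cast_nonneg _) h)
      gcongr
      exact fun h => h.1
    · have h4 := card_hit_mul_le (start := start) hfinish hunique (hsurj y) h1 h2 ω₀ v.1.val
      have h5 : ((Finset.univ.filter fun ω : ∀ x, Fin (r x + 1) =>
          blockKey start i ω = blockKey start i ω₀ ∧
            Nat.count (blockStep T ρ ω) (l1norm v) = v.1.val).card : ℝ) * (r y + 1) ≤
          (Finset.univ.filter fun ω : ∀ x, Fin (r x + 1) =>
            blockKey start i ω = blockKey start i ω₀).card := by exact_mod_cast h4
      have h6 := mul_le_mul_of_nonneg_left h5 (hp (l1norm v - i))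
      rw [mul_left_comm] at h6
      have h7 := (le_mul_of_one_le_right (Nat.cast_nonneg _) h3).trans h6
      refine le_of_eq_of_le ?_ (h7.trans_eq ?_) <;> congr!

end Blocks

/-! ### Residue classes and Kraft's condition -/

/-- Blocks formed by consecutive elements of disjoint residue classes. -/
theorem ofReal_le_distributionalComplexity_of_residues {n m : ℕ} (hn : 0 < n) {D r c : ℕ → ℕ}
    (hr : ∀ j, 0 < r j) (hc : ∀ j < m, c j < D j)
    (hdisj : ∀ i < m, ∀ j < m, ∀ t, t % D i = c i → t % D j = c j → i = j)
    {p : ℕ → ℝ} (hp : ∀ k, 0 ≤ p k) (hS : 0 < ∑ k ∈ Finset.Icc 1 n, p k)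
    (hscale : ∀ k, 0 < k → k ≤ n → 1 ≤ p k ∨
      ∃ j < m, 2 * (D j * r j) ≤ k ∧ 1 ≤ p k * (r j + 1)) :
    ENNReal.ofReal (n / (4 * ∑ k ∈ Finset.Icc 1 n, p k)) ≤ distributionalComplexity n := by
  have hD : ∀ j < m, 0 < D j * r j := fun j hj =>
    Nat.mul_pos (Nat.zero_lt_of_lt (hc j hj)) (hr j)
  refine ofReal_le_distributionalComplexity_of_blocks (κ := Fin m × Fin n)
    (r := fun x => r x.1) (T := fun x t => t % D x.1 = c x.1 ∧ t / (D x.1 * r x.1) = x.2)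
    (ρ := fun x t => t % (D x.1 * r x.1) / D x.1)
    (start := fun x => x.2 * (D x.1 * r x.1)) (finish := fun x => (x.2 + 1) * (D x.1 * r x.1))
    hn ?_ ?_ ?_ ?_ hp hS ?_
  · rintro x t ⟨-, h⟩
    rw [← h]
    exact Nat.div_mul_le_self _ _
  · rintro x t ⟨-, h⟩
    rw [← h]
    exact (Nat.div_lt_iff_lt_mul (hD _ x.1.2)).1 (Nat.lt_succ_self _)
  · rintro ⟨j, b⟩ ⟨j', b'⟩ t ⟨h1, h2⟩ ⟨h3, h4⟩
    obtain rfl : j = j' := Fin.ext (hdisj _ j.2 _ j'.2 t h1 h3)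
    obtain rfl : b = b' := Fin.ext (h2.symm.trans h4)
    rfl
  · rintro ⟨j, b⟩ u hu
    have hcj := hc j j.2
    have hlt : u * D j + c j < D j * r j := by
      calc u * D j + c j < (u + 1) * D j := by rw [add_mul, one_mul]; omega
        _ ≤ r j * D j := Nat.mul_le_mul_right _ hu
        _ = _ := mul_comm _ _
    have hdiv : (u * D j + c j) / D j = u := by
      rw [mul_comm, Nat.mul_add_div (by omega), Nat.div_eq_of_lt hcj, add_zero]
    refine ⟨D j * r j * b + (u * D j + c j), ⟨?_, ?_⟩, ?_⟩
    · have : D j * r j * b + (u * D j + c j) = c j + D j * (r j * b + u) := by ring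
      simp only [this, Nat.add_mul_mod_self_left, Nat.mod_eq_of_lt hcj]
    · simp only [Nat.mul_add_div (hD j j.2), Nat.div_eq_of_lt hlt, add_zero]
    · simp only [Nat.mul_add_mod, Nat.mod_eq_of_lt hlt, hdiv]
  · intro i ℓ hi hℓ
    refine (hscale (ℓ - i) (by omega) (by omega)).imp id ?_
    rintro ⟨j, hj, h1, h2⟩
    have hpos := hD j hj
    set M := D j * r j with hM
    have h3 : (i + M - 1) / M * M ≤ i + M - 1 := Nat.div_mul_le_self _ _
    have h4 : i + M - 1 < ((i + M - 1) / M + 1) * M :=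
      (Nat.div_lt_iff_lt_mul hpos).1 (Nat.lt_succ_self _)
    have h5 : (i + M - 1) / M ≤ (i + M - 1) / M * M := Nat.le_mul_of_pos_right _ hpos
    rw [add_mul, one_mul] at h4
    -- The first block starting at or after i has index ⌈i / M⌉; it ends by i + 2M - 1, hence by ℓ.
    refine ⟨(⟨j, hj⟩, ⟨(i + M - 1) / M, by omega⟩), ?_, ?_, h2⟩
    · simp only [← hM]
      omega
    · simp only [← hM, add_mul, one_mul]
      omega

/-- Disjoint residue classes modulo powers of two, chosen greedily under Kraft's condition. -/
theorem exists_disjoint_residues {d : ℕ → ℕ} (hd : Monotone d)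
    (hsum : ∀ m, ∑ j ∈ Finset.range m, (1 / 2 : ℝ) ^ d j < 1) (m : ℕ) :
    ∃ c : ℕ → ℕ, (∀ j < m, c j < 2 ^ d j) ∧
      ∀ j < m, ∀ i < j, c j % 2 ^ d i ≠ c i := by
  induction m with
  | zero => exact ⟨fun _ => 0, by simp, by simp⟩
  | succ m ih =>
    obtain ⟨c, hc, hdisj⟩ := ih
    obtain ⟨a, ha, hfree⟩ : ∃ a < 2 ^ d m, ∀ i < m, a % 2 ^ d i ≠ c i := by
      by_contra! hcover
      have hsub : Finset.range (2 ^ d m) ⊆ (Finset.range m).biUnion fun i =>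
          (Finset.range (2 ^ d m)).filter fun a => a % 2 ^ d i = c i := by
        intro a ha
        obtain ⟨i, hi, h⟩ := hcover a (Finset.mem_range.1 ha)
        exact Finset.mem_biUnion.2 ⟨i, Finset.mem_range.2 hi, Finset.mem_filter.2 ⟨ha, h⟩⟩
      -- As d is monotone, the class chosen for i takes up at most 2 ^ (d m - d i) residues modulo 2
      -- ^ d m. Full coverage would contradict Kraft's condition.
      have hcard : 2 ^ d m ≤ ∑ i ∈ Finset.range m, 2 ^ (d m - d i) := by
        have h := (Finset.card_le_card hsub).trans Finset.card_biUnion_le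
        rw [Finset.card_range] at h
        refine h.trans (Finset.sum_le_sum fun i hi => ?_)
        have hdi := hd (Finset.mem_range.1 hi).le
        rw [← Finset.card_range (2 ^ (d m - d i))]
        refine Finset.card_le_card_of_injOn (fun a => a / 2 ^ d i) ?_ ?_
        · intro a ha
          simp only [Finset.coe_filter, Finset.mem_range, Set.mem_ofPred_eq, Finset.coe_range,
            Set.mem_Iio] at ha ⊢
          rw [Nat.div_lt_iff_lt_mul (by positivity), ← pow_add, Nat.sub_add_cancel hdi]
          exact ha.1
        · intro a ha b hb hab
          simp only [Finset.coe_filter, Set.mem_ofPred_eq] at ha hb hab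
          rw [← Nat.div_add_mod a (2 ^ d i), ← Nat.div_add_mod b (2 ^ d i), hab, ha.2, hb.2]
      have h1 := mul_lt_mul_of_pos_left (hsum m) (pow_pos (two_pos (α := ℝ)) (d m))
      rw [mul_one, Finset.mul_sum] at h1
      have h2 : ((2 ^ d m : ℕ) : ℝ) ≤ ((∑ i ∈ Finset.range m, 2 ^ (d m - d i) : ℕ) : ℝ) := by
        exact_mod_cast hcard
      push_cast at h2
      refine absurd (h2.trans_eq (Finset.sum_congr rfl fun i hi => ?_)) (not_le.2 h1)
      rw [pow_sub₀ _ two_ne_zero (hd (Finset.mem_range.1 hi).le), one_div, inv_pow]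
    refine ⟨Function.update c m a, fun j hj => ?_, fun j hj i hi => ?_⟩
    · rcases Nat.lt_succ_iff_lt_or_eq.1 hj with h | rfl
      · rw [Function.update_of_ne h.ne]
        exact hc j h
      · rwa [Function.update_self]
    · rw [Function.update_of_ne (show i ≠ m by omega)]
      rcases Nat.lt_succ_iff_lt_or_eq.1 hj with h | rfl
      · rw [Function.update_of_ne h.ne]
        exact hdisj j h i hi
      · rw [Function.update_self]
        exact hfree i hi

theorem ofReal_le_distributionalComplexity_of_exponents {n : ℕ} (hn : 0 < n) {d : ℕ → ℕ}
    (hd : Monotone d) (hsum : ∀ m, ∑ j ∈ Finset.range m, (1 / 2 : ℝ) ^ d j < 1)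
    {p : ℕ → ℝ} (hp : ∀ k, 0 ≤ p k) (hS : 0 < ∑ k ∈ Finset.Icc 1 n, p k)
    (hscale : ∀ k, 0 < k → k ≤ n → 1 ≤ p k ∨
      ∃ j, d j ≤ j ∧ 2 ^ (j + 1) ≤ k ∧ 1 ≤ p k * 2 ^ (j - d j)) :
    ENNReal.ofReal (n / (4 * ∑ k ∈ Finset.Icc 1 n, p k)) ≤ distributionalComplexity n := by
  obtain ⟨c, hc, hdisj⟩ := exists_disjoint_residues hd hsum n
  have hlt : ∀ j < n, ∀ i < j, ∀ t, t % 2 ^ d i = c i → t % 2 ^ d j = c j → False := by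
    intro j hj i hi t h1 h2
    apply hdisj j hj i hi
    rw [← h2, Nat.mod_mod_of_dvd _ (pow_dvd_pow 2 (hd hi.le)), h1]
  -- Scales below n suffice, since 2 ^ (j + 1) ≤ k ≤ n forces j < n. If d j > j, truncated
  -- subtraction gives r = 1; `hscale` never selects such a scale.
  refine ofReal_le_distributionalComplexity_of_residues (m := n) (D := fun j => 2 ^ d j)
    (r := fun j => 2 ^ (j - d j)) hn (fun j => by positivity) hc ?_ hp hS ?_
  · intro i hi j hj t h1 h2
    rcases lt_trichotomy i j with h | h | h
    · exact (hlt j hj i h t h1 h2).elim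
    · exact h
    · exact (hlt i hi j h t h2 h1).elim
  · intro k hk hkn
    refine (hscale k hk hkn).imp id ?_
    rintro ⟨j, h1, h2, h3⟩
    refine ⟨j, ?_, ?_, ?_⟩
    · have := (Nat.lt_two_pow_self (n := j + 1))
      omega
    · rw [← pow_add, Nat.add_sub_cancel' h1, ← pow_succ']
      exact h2
    · push_cast
      nlinarith [hp k]

/-! ### Condensation and the choice of densities -/

theorem summable_apply_two_pow {h : ℕ → ℝ} (h_pos : ∀ k : ℕ, 1 ≤ k → 0 < h k)
    (h_anti : AntitoneOn h (Set.Ici 1))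
    (h_sum : Summable fun k : ℕ => h (k + 1) / ((k + 1 : ℕ) : ℝ)) :
    Summable fun j : ℕ => h (2 ^ j) := by
  have h1 : Summable fun k : ℕ => h k / (k : ℝ) := (summable_nat_add_iff 1).1 h_sum
  rw [← summable_condensed_iff_of_nonneg] at h1
  · refine h1.congr fun j => ?_
    push_cast
    field_simp
  · intro k
    rcases Nat.eq_zero_or_pos k with rfl | hk
    · simp
    · exact div_nonneg (h_pos k hk).le (Nat.cast_nonneg _)
  · intro a b ha hab
    have ha' : (0 : ℝ) < a := by exact_mod_cast ha
    have hab' : (a : ℝ) ≤ b := by exact_mod_cast hab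
    exact div_le_div₀ (h_pos a ha).le
      (h_anti (Set.mem_Ici.2 ha) (Set.mem_Ici.2 (by omega)) hab) ha' hab'

/-- Rounding a small antitone sequence down to powers of two. -/
theorem exists_exponents {a : ℕ → ℝ} (ha : Antitone a) (hpos : ∀ j, 0 < a j) (hlt : ∀ j, a j < 1) :
    ∃ d : ℕ → ℕ, Monotone d ∧ (∀ j, (1 / 2 : ℝ) ^ d j ≤ a j) ∧
      ∀ j, a j < 2 * (1 / 2 : ℝ) ^ d j := by
  classical
  have hex : ∀ j, ∃ e : ℕ, (1 / 2 : ℝ) ^ e ≤ a j := fun j => by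
    obtain ⟨e, he⟩ := exists_pow_lt_of_lt_one (hpos j) (by norm_num : (1 / 2 : ℝ) < 1)
    exact ⟨e, he.le⟩
  refine ⟨fun j => Nat.find (hex j), fun i j hij => Nat.find_mono fun e he => he.trans (ha hij),
    fun j => Nat.find_spec (hex j), fun j => ?_⟩
  -- The least exponent is positive because a j < 1, so its predecessor fails; this gives the factor
  -- 2.
  have h0 : Nat.find (hex j) ≠ 0 := by
    intro h
    have := Nat.find_spec (hex j)
    rw [h, pow_zero] at this
    linarith [hlt j]
  obtain ⟨e, he⟩ := Nat.exists_eq_succ_of_ne_zero h0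
  have := Nat.find_min (hex j) (m := e) (by omega)
  simp only [he]
  rw [Nat.succ_eq_add_one, pow_succ]
  linarith

end GridPath

open GridPath in
theorem mainTheorem5 (h : ℕ → ℝ)
    (h_pos : ∀ k : ℕ, 1 ≤ k → 0 < h k)
    (h_anti : AntitoneOn h (Set.Ici 1))
    (h_sum : Summable fun k : ℕ => h (k + 1) / ((k + 1 : ℕ) : ℝ)) :
    ∃ c : ℝ, 0 < c ∧ ∃ N : ℕ, ∀ n : ℕ, N ≤ n →
      ENNReal.ofReal (c * ((n : ℝ) / GridPath.partialSum h n)) ≤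
          GridPath.distributionalComplexity n ∧
        ENNReal.ofReal (c * ((n : ℝ) / GridPath.partialSum h n)) ≤
          GridPath.randomizedComplexity n := by
  have hsummable := summable_apply_two_pow h_pos h_anti h_sum
  have hpow : ∀ j : ℕ, 0 < h (2 ^ j) := fun j => h_pos _ Nat.one_le_two_pow
  set Z := ∑' j : ℕ, h (2 ^ j) with hZ
  have hZ0 : 0 ≤ Z := tsum_nonneg fun j => (hpow j).le
  -- Dividing by Z + 1 rather than Z makes the Kraft inequality strict.
  have hpartial : ∀ s : Finset ℕ, ∑ j ∈ s, h (2 ^ j) / (Z + 1) < 1 := fun s => by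
    rw [← Finset.sum_div, div_lt_one (by linarith)]
    linarith [hsummable.sum_le_tsum s fun j _ => (hpow j).le]
  have hone : ∀ j, h (2 ^ j) / (Z + 1) < 1 := fun j => by simpa using hpartial {j}
  obtain ⟨d, hd, hd1, hd2⟩ := exists_exponents (a := fun j => h (2 ^ j) / (Z + 1))
    (fun i j hij => div_le_div_of_nonneg_right (h_anti (Set.mem_Ici.2 Nat.one_le_two_pow)
      (Set.mem_Ici.2 Nat.one_le_two_pow) (Nat.pow_le_pow_right two_pos hij)) (by linarith))
    (fun j => div_pos (hpow j) (by linarith)) hone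
  -- The 8 combines k < 4 · 2 ^ j with the factor 2 lost in rounding to powers of two.
  have hC : 0 < 8 * (Z + 1) := by linarith
  refine ⟨1 / (4 * (8 * (Z + 1))), by positivity, 1, fun n hn => ?_⟩
  have hterm : ∀ k ∈ Finset.Icc 1 n, 0 < 1 / ((k : ℝ) * h k) := fun k hk => by
    have hk1 := (Finset.mem_Icc.1 hk).1
    have := h_pos k hk1
    have : (0 : ℝ) < k := by exact_mod_cast hk1
    positivity
  have hS : 0 < partialSum h n :=
    Finset.sum_pos hterm ⟨1, Finset.mem_Icc.2 ⟨le_rfl, hn⟩⟩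
  have hsum_eq : ∑ k ∈ Finset.Icc 1 n, 8 * (Z + 1) * (1 / ((k : ℝ) * h k)) =
      8 * (Z + 1) * partialSum h n := (Finset.mul_sum _ _ _).symm
  have hmain : ENNReal.ofReal (1 / (4 * (8 * (Z + 1))) * ((n : ℝ) / partialSum h n)) ≤
      distributionalComplexity n := by
    have heq : 1 / (4 * (8 * (Z + 1))) * ((n : ℝ) / partialSum h n) =
        n / (4 * ∑ k ∈ Finset.Icc 1 n, 8 * (Z + 1) * (1 / ((k : ℝ) * h k))) := by
      rw [hsum_eq]
      field_simp
    rw [heq]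
    refine ofReal_le_distributionalComplexity_of_exponents hn hd
      (fun m => (Finset.sum_le_sum fun j _ => hd1 j).trans_lt (hpartial _)) ?_ ?_ ?_
    · intro k
      rcases Nat.eq_zero_or_pos k with rfl | hk
      · simp
      · have := h_pos k hk
        positivity
    · rw [hsum_eq]
      positivity
    · intro k hk hkn
      have hhk := h_pos k hk
      have hk0 : (0 : ℝ) < k := by exact_mod_cast hk
      have hkh : 0 < (k : ℝ) * h k := mul_pos hk0 hhk
      rcases Nat.lt_or_ge k 2 with h2 | h2
      · left
        obtain rfl : k = 1 := by omega
        have := hone 0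
        rw [pow_zero, div_lt_one (by linarith)] at this
        rw [mul_one_div, le_div_iff₀ hkh]
        push_cast
        linarith
      · obtain ⟨j, hj⟩ : ∃ j, Nat.log 2 k = j + 1 :=
          Nat.exists_eq_succ_of_ne_zero (Nat.log_pos one_lt_two h2).ne'
        have hlow : 2 ^ (j + 1) ≤ k := hj ▸ Nat.pow_log_le_self 2 hk.ne'
        have hup : k < 2 ^ (j + 2) := by
          have := Nat.lt_pow_succ_log_self one_lt_two k
          rwa [hj] at this
        have hup' : (k : ℝ) < 4 * 2 ^ j := by
          have : (k : ℝ) < 2 ^ (j + 2) := by exact_mod_cast hup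
          rw [pow_add] at this
          linarith
        have hanti : h k ≤ h (2 ^ j) :=
          h_anti (Set.mem_Ici.2 Nat.one_le_two_pow) (Set.mem_Ici.2 hk)
            ((Nat.pow_le_pow_right two_pos (Nat.le_succ j)).trans hlow)
        have hdj := hd2 j
        rw [div_lt_iff₀ (by linarith)] at hdj
        have hkey : (k : ℝ) * h k ≤ 8 * (Z + 1) * (2 ^ j * (1 / 2) ^ d j) := by
          calc (k : ℝ) * h k ≤ (4 * 2 ^ j) * (2 * (1 / 2) ^ d j * (Z + 1)) := by
                gcongr
                exact hanti.trans hdj.le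
            _ = _ := by ring
        by_cases hdl : d j ≤ j
        · right
          refine ⟨j, hdl, hlow, ?_⟩
          rw [mul_one_div, div_mul_eq_mul_div, le_div_iff₀ hkh, one_mul,
            pow_sub₀ _ two_ne_zero hdl, ← inv_pow, ← one_div]
          exact hkey
        -- For d j > j the class is too sparse for its scale, but then k h k ≤ 8 (Z + 1) and the
        -- trivial bound 1 ≤ p k holds.
        · left
          rw [mul_one_div, le_div_iff₀ hkh, one_mul]
          refine hkey.trans (mul_le_of_le_one_right hC.le ?_)
          rw [one_div, inv_pow, ← div_eq_mul_inv, div_le_one (by positivity)]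
          exact pow_le_pow_right₀ one_le_two (by omega)
  exact ⟨hmain, hmain.trans (distributionalComplexity_le_randomizedComplexity n)⟩
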